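/- Let $A$ be a compact metric space, let $\mathcal M(A)$ be the space of Borel probability measures on $A$ with the weak topology, and let $\mathcal U_A$ be the space of bounded continuous functions $u:A\times\mathcal M(A)\to\mathbb R$ with the sup norm and its Borel $\sigma$-algebra. A large game is a measurable map $G:(I,\mathcal I,\lambda)\to\mathcal U_A$, $G(i)=u_i$, where $(I,\mathcal I,\lambda)$ is a complete atomless probability space. For a measurable $g:I\to\mathcal M(A)$ put $s(g)=\int_I g(i)\,d\lambda(i)\in\mathcal M(A)$; $g$ is a Nash equilibrium of $G$ if for $\lambda$-almost every $i\in I$, $$\int_A u_i(a,s(g))\,g(i,da)\ \ge\ \int_A u_i(a,s(g))\,\mu(da)\qquad\text{for all }\mu\in\mathcal M(A).$$ Let $\tau^*=s(g)$ for some Nash equilibrium $g$ of $G$. An auxiliary mapping associated with $\tau^*$ is a function $\bar g:\mathcal U_A\to\mathcal M(A)$ such that $\bar g\circ G$ is measurable and is a Nash equilibrium of $G$ with $s(\bar g\circ G)=\tau^*$. For each integer $n\ge 1$ let $I_n$ be a set of $n$ players with the uniform probability measure $\lambda_n$, and let $G_n:I_n\to\mathcal U_A$, $G_n(i)=u_i^n$,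 be a finite-player game. For $h:I_n\to\mathcal M(A)$ the expected payoff of player $i$ is $$U_i^n(h)=\int_{A^{I_n}}u_i^n\Bigl(a_i,\ \tfrac1n\sum_{j\in I_n}\delta_{a_j}\Bigr)\ \bigotimes_{j\in I_n}h(j)(da_j).$$ For $\varepsilon\ge 0$, $h$ is an $\varepsilon$-Nash equilibrium of $G_n$ if there is $S\subseteq I_n$ with $\lambda_n(S)\ge 1-\varepsilon$ such that $U_i^n(h)\ge U_i^n(\mu,h_{-i})-\varepsilon$ for all $i\in S$ and $\mu\in\mathcal M(A)$, where $(\mu,h_{-i})$ is $h$ with the strategy of player $i$ replaced by $\mu$. Theorem. Let $G$ be a large game and $(G_n)_{n\ge1}$ finite-player games with $G_n(I_n)\subseteq\operatorname{supp}\lambda G^{-1}$ for all $n$, such that $\lambda_nG_n^{-1}\to\lambda G^{-1}$ weakly on $\mathcal U_A$. Let $\bar g$ be an auxiliary mapping of $G$ associated with an equilibrium action distribution $\tau^*$, and suppose that $\bar g$ is almost everywhere continuous on $\operatorname{supp}\lambda G^{-1}$, i.e. the restriction of $\bar g$ to $\operatorname{supp}\lambda G^{-1}$ is continuous at $\lambda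 G^{-1}$-almost every point of $\operatorname{supp}\lambda G^{-1}$. Then there are $\varepsilon_n\ge0$ with $\varepsilon_n\to0$ such that for every $n\ge1$ the direct strategy profile $g^n=\bar g\circ G_n$ is an $\varepsilon_n$-Nash equilibrium of $G_n$. -/

import Mathlib

open Filter Topology MeasureTheory
open scoped BoundedContinuousFunction ENNReal

namespace LargeGame

noncomputable section

/-- The space of payoff functions (player characteristics): bounded continuous real functions on
`A × M(A)`, where `M(A)` carries the topology of weak convergence. The topology of this space is
the one of the sup norm. -/
abbrev Payoff (A : Type*) [TopologicalSpace A] [MeasurableSpace A] [OpensMeasurableSpace A] :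
    Type _ :=
  (A × ProbabilityMeasure A) →ᵇ ℝ

/-- The space of payoff functions carries its Borel sigma-algebra. -/
instance instMeasurableSpacePayoff (A : Type*) [TopologicalSpace A] [MeasurableSpace A]
    [OpensMeasurableSpace A] : MeasurableSpace (Payoff A) :=
  borel _

instance instBorelSpacePayoff (A : Type*) [TopologicalSpace A] [MeasurableSpace A]
    [OpensMeasurableSpace A] : BorelSpace (Payoff A) :=
  ⟨rfl⟩

/-- A measure is atomless if every measurable set of positive measure has a measurable subset of
positive and strictly smaller measure. -/
def IsAtomless {I : Type*} [MeasurableSpace I] (P : Measure I) : Prop :=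
  ∀ s, MeasurableSet s → 0 < P s → ∃ t, t ⊆ s ∧ MeasurableSet t ∧ 0 < P t ∧ P t < P s

/-- The distribution `P ∘ G⁻¹` of player characteristics of a game `G`. -/
def charDist {I A : Type*} [MeasurableSpace I] [TopologicalSpace A] [MeasurableSpace A]
    [OpensMeasurableSpace A] (P : Measure I) [IsProbabilityMeasure P] (G : I → Payoff A)
    (hG : Measurable G) : ProbabilityMeasure (Payoff A) :=
  ⟨P.map G, Measure.isProbabilityMeasure_map hG.aemeasurable⟩

/-- The expected payoff `∫ u (a, τ) μ(da)` from the randomized strategy `μ` against the fixed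
societal summary `τ`. -/
def payoffAgainst {A : Type*} [TopologicalSpace A] [MeasurableSpace A] [OpensMeasurableSpace A]
    (u : Payoff A) (μ τ : ProbabilityMeasure A) : ℝ :=
  ∫ a, u (a, τ) ∂(μ : Measure A)

/-! ### Large games -/

/-- The societal summary `s(g) = ∫ g(i) dP(i)` of a randomized strategy profile `g`, that is,
`s(g)(B) = ∫ g(i)(B) dP(i)`. -/
def societalSummary {I A : Type*} [MeasurableSpace I] [MeasurableSpace A]
    (P : Measure I) [IsProbabilityMeasure P] (g : I → ProbabilityMeasure A) (hg : Measurable g) :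
    ProbabilityMeasure A :=
  ⟨P.bind (fun i => (g i : Measure A)),
    isProbabilityMeasure_bind (measurable_subtype_coe.comp hg).aemeasurable
      (Eventually.of_forall fun i => (g i).2)⟩

/-- The measurable profile `g` is a randomized strategy Nash equilibrium of the large game `G`:
almost every player best-responds to the societal summary of `g`. -/
def IsNash {I A : Type*} [MeasurableSpace I] [TopologicalSpace A] [MeasurableSpace A]
    [OpensMeasurableSpace A] (P : Measure I) [IsProbabilityMeasure P] (G : I → Payoff A)
    (g : I → ProbabilityMeasure A) (hg : Measurable g) : Prop :=
  ∀ᵐ i ∂P, ∀ μ : ProbabilityMeasure A,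
    payoffAgainst (G i) μ (societalSummary P g hg) ≤
      payoffAgainst (G i) (g i) (societalSummary P g hg)

/-- `τ` is the societal summary of some Nash equilibrium of the large game `G`. -/
def IsEquilibriumActionDistribution {I A : Type*} [MeasurableSpace I] [TopologicalSpace A]
    [MeasurableSpace A] [OpensMeasurableSpace A] (P : Measure I) [IsProbabilityMeasure P]
    (G : I → Payoff A) (τ : ProbabilityMeasure A) : Prop :=
  ∃ (g : I → ProbabilityMeasure A) (hg : Measurable g),
    IsNash P G g hg ∧ societalSummary P g hg = τ

/-- `gbar` is an auxiliary mapping of the large game `G` associated with `τ`: the profile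
`gbar ∘ G` is a (measurable) Nash equilibrium of `G` with societal summary `τ`. -/
def IsAuxiliaryMapping {I A : Type*} [MeasurableSpace I] [TopologicalSpace A]
    [MeasurableSpace A] [OpensMeasurableSpace A] (P : Measure I) [IsProbabilityMeasure P]
    (G : I → Payoff A) (τ : ProbabilityMeasure A) (gbar : Payoff A → ProbabilityMeasure A) :
    Prop :=
  ∃ hg : Measurable (gbar ∘ G),
    IsNash P G (gbar ∘ G) hg ∧ societalSummary P (gbar ∘ G) hg = τ

/-- `gbar` is almost everywhere continuous on the support of `W`: at `W`-almost every point of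
`supp W`, the restriction of `gbar` to `supp W` is continuous. -/
def AEContinuousOnSupport {A : Type*} [TopologicalSpace A] [MeasurableSpace A]
    [OpensMeasurableSpace A] (W : ProbabilityMeasure (Payoff A))
    (gbar : Payoff A → ProbabilityMeasure A) : Prop :=
  ∀ᵐ u ∂(W : Measure (Payoff A)), u ∈ (W : Measure (Payoff A)).support →
    ContinuousWithinAt gbar (W : Measure (Payoff A)).support u

/-! ### Finite-player games -/

/-- The uniform probability measure on a finite set of players, giving every player weight
`1 / |J|`. -/
def playerMeasure (J : Type*) [Fintype J] [MeasurableSpace J] : Measure J :=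
  ∑ j : J, (Fintype.card J : ℝ≥0∞)⁻¹ • Measure.dirac j

theorem playerMeasure_singleton {J : Type*} [Fintype J] [MeasurableSpace J]
    [DiscreteMeasurableSpace J] (j : J) :
    playerMeasure J {j} = (Fintype.card J : ℝ≥0∞)⁻¹ := by
  classical
  simp [playerMeasure, Set.indicator_apply]

theorem card_mul_inv_eq_one (J : Type*) [Fintype J] [Nonempty J] :
    (Fintype.card J : ℝ≥0∞) * (Fintype.card J : ℝ≥0∞)⁻¹ = 1 :=
  ENNReal.mul_inv_cancel (by simp) (by simp)

instance instIsProbabilityMeasurePlayerMeasure (J : Type*) [Fintype J] [Nonempty J]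
    [MeasurableSpace J] : IsProbabilityMeasure (playerMeasure J) :=
  ⟨by simp [playerMeasure, card_mul_inv_eq_one]⟩

/-- The societal summary `∑ j, λ({j}) δ_{a j}` of a pure strategy profile `a` of a finite set of
players, `λ` being the uniform measure on the players. -/
def empirical {J A : Type*} [Fintype J] [Nonempty J] [MeasurableSpace J]
    [DiscreteMeasurableSpace J] [MeasurableSpace A] (a : J → A) : ProbabilityMeasure A :=
  ⟨∑ j : J, playerMeasure J {j} • Measure.dirac (a j),
    ⟨by simp [playerMeasure_singleton, card_mul_inv_eq_one]⟩⟩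

/-- The expected payoff of player `i` in the finite-player game `G` if the players randomize
independently according to the profile `g`. -/
def expectedPayoff {J A : Type*} [Fintype J] [Nonempty J] [MeasurableSpace J]
    [DiscreteMeasurableSpace J] [TopologicalSpace A] [MeasurableSpace A] [OpensMeasurableSpace A]
    (G : J → Payoff A) (g : J → ProbabilityMeasure A) (i : J) : ℝ :=
  ∫ a : J → A, G i (a i, empirical a) ∂(Measure.pi fun j => (g j : Measure A))

open Classical in
/-- The profile `g` is an `ε`-Nash equilibrium of the finite-player game `G`: there is a set of
players of measure at least `1 - ε`, none of whom can gain more than `ε` by a unilateral deviation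
to another randomized strategy. -/
def IsEpsNash {J A : Type*} [Fintype J] [Nonempty J] [MeasurableSpace J]
    [DiscreteMeasurableSpace J] [TopologicalSpace A] [MeasurableSpace A] [OpensMeasurableSpace A]
    (G : J → Payoff A) (ε : ℝ) (g : J → ProbabilityMeasure A) : Prop :=
  ∃ S : Set J, 1 - ε ≤ (playerMeasure J).real S ∧
    ∀ i ∈ S, ∀ μ : ProbabilityMeasure A,
      expectedPayoff G (Function.update g i μ) i - ε ≤ expectedPayoff G g i

/-- The direct strategy profile `gbar ∘ G` of a finite-player game `G`. -/
def directProfile {J A : Type*} [TopologicalSpace A] [MeasurableSpace A]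
    [OpensMeasurableSpace A] (gbar : Payoff A → ProbabilityMeasure A) (G : J → Payoff A) :
    J → ProbabilityMeasure A :=
  gbar ∘ G

end

end LargeGame

/-! When many players randomize independently, the random societal summary concentrates near the
average of their strategies, and one deviation moves that average by only O(1/n). For direct
profiles the average is the integral of `gbar` over the law of characteristics of the finite game.
These laws live on the support, where `gbar` is almost everywhere continuous, so weak convergence
sends the average to `τ` (`tendsto_integral_directProfile`,
`eventually_measure_empirical_notMem_le`). Expected payoffs are then close to payoffs against the
fixed summary `τ`.

It remains that `gbar u` almost best-responds to `τ` for most `u`. Exact best response passes to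
continuity points by density. Approximate best response, with uniform control of the payoffs, then
holds on an open set of nearly full measure (`exists_isOpen_good_characteristics`), and the
portmanteau theorem gives that set nearly full measure in the finite games.

Only `gbar ∘ G` is known to be measurable, not `gbar`, so the limit arguments avoid measurability in
`u`. -/

namespace LargeGame

/-! ### Weak convergence and semicontinuous integrands -/

/-- A bounded function is approximated from above by bounded continuous functions, which converge
to it at every point of upper semicontinuity. -/
theorem exists_boundedContinuous_approx_above {X : Type*} [PseudoMetricSpace X] {φ : X → ℝ}
    {C : ℝ} (hC : ∀ x, |φ x| ≤ C) :
    ∃ ψ : ℕ → (X →ᵇ ℝ), (∀ k x, φ x ≤ ψ k x) ∧ (∀ k x, |ψ k x| ≤ C) ∧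
      ∀ x, UpperSemicontinuousAt φ x → Tendsto (fun k => ψ k x) atTop (𝓝 (φ x)) := by
  -- Sup-convolution: the least `k`-Lipschitz majorant of `φ`.
  let ψ : ℕ → X → ℝ := fun k x => ⨆ v, (φ v - k * dist x v)
  have hle : ∀ (k : ℕ) x v, φ v - k * dist x v ≤ C := fun k x v => by
    have := (abs_le.1 (hC v)).2
    have : 0 ≤ (k : ℝ) * dist x v := mul_nonneg k.cast_nonneg dist_nonneg
    linarith
  have hbdd : ∀ (k : ℕ) x, BddAbove (Set.range fun v => φ v - k * dist x v) := fun k x =>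
    ⟨C, by rintro _ ⟨v, rfl⟩; exact hle k x v⟩
  have hge : ∀ (k : ℕ) x, φ x ≤ ψ k x := fun k x => by
    simpa using le_ciSup (hbdd k x) x
  have hub : ∀ (k : ℕ) x, ψ k x ≤ C := fun k x => by
    have : Nonempty X := ⟨x⟩
    exact ciSup_le (hle k x)
  have habs : ∀ (k : ℕ) x, |ψ k x| ≤ C := fun k x =>
    abs_le.2 ⟨(abs_le.1 (hC x)).1.trans (hge k x), hub k x⟩
  have hlip : ∀ k : ℕ, LipschitzWith k (ψ k) := fun k => by
    refine LipschitzWith.of_le_add_mul _ fun x y => ?_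
    have : Nonempty X := ⟨x⟩
    refine ciSup_le fun v => ?_
    have h1 := le_ciSup (hbdd k y) v
    have h2 : (k : ℝ) * dist y v ≤ k * (dist x y + dist x v) := by
      gcongr
      rw [dist_comm x y]
      exact dist_triangle y x v
    simp only [NNReal.coe_natCast]
    change φ v - k * dist y v ≤ ψ k y at h1
    linarith
  refine ⟨fun k => BoundedContinuousFunction.ofNormedAddCommGroup (ψ k) (hlip k).continuous C
    (habs k), hge, habs, fun x hx => ?_⟩
  refine tendsto_order.2 ⟨fun a ha => .of_forall fun k => ha.trans_le (hge k x), fun b hb => ?_⟩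
  obtain ⟨c, hxc, hcb⟩ := exists_between hb
  obtain ⟨δ, hδ, hball⟩ := Metric.eventually_nhds_iff.1 (hx c hxc)
  -- For such `k`, points at distance at least `δ` contribute at most `C - 2 * C = -C ≤ φ x`.
  filter_upwards [tendsto_natCast_atTop_atTop.eventually_ge_atTop (2 * C / δ)] with k hk
  refine lt_of_le_of_lt ?_ hcb
  have : Nonempty X := ⟨x⟩
  refine ciSup_le fun v => ?_
  by_cases hv : dist v x < δ
  · have : 0 ≤ (k : ℝ) * dist x v := mul_nonneg k.cast_nonneg dist_nonneg
    linarith [hball hv]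
  · rw [dist_comm, not_lt] at hv
    have h1 : 2 * C ≤ k * dist x v := by
      rw [div_le_iff₀ hδ] at hk
      exact hk.trans (by gcongr)
    linarith [(abs_le.1 (hC v)).2, (abs_le.1 (hC x)).1]

/-- Integrals of a bounded, almost everywhere upper semicontinuous function (which need not be
measurable) are asymptotically bounded along weakly convergent laws of discrete variables. -/
theorem eventually_integral_comp_lt {I X ι : Type*} [MeasurableSpace I] [PseudoMetricSpace X]
    [MeasurableSpace X] [BorelSpace X] {P : Measure I} [IsProbabilityMeasure P]
    {G : I → X} (hG : Measurable G) {l : Filter ι} {J : ι → Type*} [∀ n, MeasurableSpace (J n)]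
    [∀ n, DiscreteMeasurableSpace (J n)] [∀ n, Finite (J n)] {Q : ∀ n, Measure (J n)}
    [∀ n, IsProbabilityMeasure (Q n)] {Gn : ∀ n, J n → X}
    (h : ∀ ψ : X →ᵇ ℝ, Tendsto (fun n => ∫ j, ψ (Gn n j) ∂Q n) l (𝓝 (∫ i, ψ (G i) ∂P)))
    {φ : X → ℝ} {C : ℝ} (hC : ∀ x, |φ x| ≤ C)
    (hφ : ∀ᵐ i ∂P, UpperSemicontinuousAt φ (G i)) {c : ℝ} (hc : ∫ i, φ (G i) ∂P < c) :
    ∀ᶠ n in l, ∫ j, φ (Gn n j) ∂Q n < c := by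
  obtain ⟨ψ, hle, hbdd, hlim⟩ := exists_boundedContinuous_approx_above hC
  -- Dominated convergence needs measurability only of the approximants, so none is asked of `φ`.
  have hψ : Tendsto (fun k => ∫ i, ψ k (G i) ∂P) atTop (𝓝 (∫ i, φ (G i) ∂P)) := by
    refine tendsto_integral_of_dominated_convergence (fun _ => C)
      (fun k => ((ψ k).continuous.measurable.comp hG).aestronglyMeasurable)
      (integrable_const _) (fun k => .of_forall fun i => hbdd k _) ?_
    filter_upwards [hφ] with i hi using hlim _ hi
  obtain ⟨k, hk⟩ := (hψ.eventually_lt_const hc).exists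
  filter_upwards [(h (ψ k)).eventually_lt_const hk] with n hn
  exact (integral_mono .of_finite .of_finite fun j => hle k _).trans_lt hn

/-! ### Concentration of the empirical distribution -/

section Summary

variable {J A : Type*} [Fintype J] [Nonempty J] [MeasurableSpace J] [DiscreteMeasurableSpace J]

theorem integral_playerMeasure (φ : J → ℝ) :
    ∫ j, φ j ∂playerMeasure J = (Fintype.card J : ℝ)⁻¹ * ∑ j, φ j := by
  rw [integral_fintype .of_finite, Finset.mul_sum]
  simp [Measure.real, playerMeasure_singleton]

theorem integral_empirical [TopologicalSpace A] [MeasurableSpace A] [OpensMeasurableSpace A]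
    (f : A →ᵇ ℝ) (a : J → A) :
    ∫ x, f x ∂(empirical a : Measure A) = (Fintype.card J : ℝ)⁻¹ * ∑ j, f (a j) := by
  have : (empirical a : Measure A) = ∑ j : J, playerMeasure J {j} • Measure.dirac (a j) := rfl
  have hi : ∀ j, Integrable f (Measure.dirac (a j)) := fun j => f.integrable _
  rw [this, integral_finsetSum_measure fun j _ => (hi j).smul_measure (by simp),
    Finset.mul_sum]
  refine Finset.sum_congr rfl fun j _ => ?_
  rw [integral_smul_measure, integral_dirac' _ _ f.continuous.stronglyMeasurable]
  simp [playerMeasure_singleton]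

theorem continuous_empirical [TopologicalSpace A] [MeasurableSpace A] [OpensMeasurableSpace A] :
    Continuous (empirical : (J → A) → ProbabilityMeasure A) := by
  refine continuous_iff_continuousAt.2 fun a => ?_
  refine ProbabilityMeasure.tendsto_iff_forall_integral_tendsto.2 fun f => ?_
  simp_rw [integral_empirical]
  exact (Continuous.continuousAt (by fun_prop))

/-- Chebyshev's inequality for the societal summary of independent random actions. -/
theorem measure_integral_empirical_deviation_le [TopologicalSpace A] [MeasurableSpace A]
    [OpensMeasurableSpace A] (h : J → ProbabilityMeasure A) (f : A →ᵇ ℝ) {η : ℝ} (hη : 0 < η) :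
    Measure.pi (fun j => (h j : Measure A))
      {a | η ≤ |∫ x, f x ∂(empirical a : Measure A) -
        ∫ j, ∫ x, f x ∂(h j : Measure A) ∂playerMeasure J|} ≤
      ENNReal.ofReal ((Fintype.card J : ℝ)⁻¹ * (‖f‖ ^ 2 / η ^ 2)) := by
  set n : ℝ := (Fintype.card J : ℝ)
  have hn : 0 < n := by simp [n, Fintype.card_pos]
  have hmem : ∀ j, MemLp f 2 (h j : Measure A) := fun j =>
    MemLp.of_bound f.continuous.stronglyMeasurable.aestronglyMeasurable ‖f‖
      (.of_forall f.norm_coe_le_norm)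
  have hmem' : ∀ j, MemLp (fun a : J → A => f (a j)) 2 (Measure.pi fun j => (h j : Measure A)) :=
    fun j => (hmem j).comp_measurePreserving (measurePreserving_eval _ j)
  set X : (J → A) → ℝ := fun a => n⁻¹ * (∑ j, fun a : J → A => f (a j)) a
  have hX : MemLp X 2 (Measure.pi fun j => (h j : Measure A)) :=
    (memLp_finsetSum' _ fun j _ => hmem' j).const_mul _
  have hvar : ProbabilityTheory.variance X (Measure.pi fun j => (h j : Measure A)) ≤
      n⁻¹ * ‖f‖ ^ 2 := by
    have hj : ∀ j, ProbabilityTheory.variance f (h j : Measure A) ≤ ‖f‖ ^ 2 := fun j => by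
      have := ProbabilityTheory.variance_le_sq_of_bounded (μ := (h j : Measure A)) (a := -‖f‖)
        (b := ‖f‖) (X := f)
        (.of_forall fun x => abs_le.1 (f.norm_coe_le_norm x))
        f.continuous.measurable.aemeasurable
      convert this using 2
      ring
    -- Under the product measure the actions are independent, so their variances add.
    rw [ProbabilityTheory.variance_const_mul,
      ProbabilityTheory.variance_sum_pi (X := fun _ => f) hmem]
    calc n⁻¹ ^ 2 * ∑ j, ProbabilityTheory.variance f (h j : Measure A)
        ≤ n⁻¹ ^ 2 * ∑ _j : J, ‖f‖ ^ 2 := by gcongr with j; exact hj j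
      _ = n⁻¹ * ‖f‖ ^ 2 := by
        simp only [Finset.sum_const, Finset.card_univ, nsmul_eq_mul]
        change n⁻¹ ^ 2 * (n * _) = _
        field_simp
  have hmean : ∫ a, X a ∂(Measure.pi fun j => (h j : Measure A)) =
      ∫ j, ∫ x, f x ∂(h j : Measure A) ∂playerMeasure J := by
    simp only [X, integral_playerMeasure, Finset.sum_apply]
    rw [integral_const_mul, integral_finsetSum _ fun j _ => (hmem' j).integrable (by norm_num)]
    congr 1
    refine Finset.sum_congr rfl fun j _ => ?_
    exact integral_comp_eval (μ := fun j => (h j : Measure A))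
      f.continuous.stronglyMeasurable.aestronglyMeasurable
  have := ProbabilityTheory.meas_ge_le_variance_div_sq hX hη
  rw [hmean] at this
  simp only [integral_empirical]
  simp only [X, Finset.sum_apply] at this
  refine this.trans (ENNReal.ofReal_le_ofReal ?_)
  rw [← mul_div_assoc]
  gcongr
  simpa only [X, Finset.sum_apply] using hvar

end Summary

end LargeGame

namespace LargeGame

/-! ### Law of large numbers under unilateral deviations -/

section Randomized

variable {A : Type*} [TopologicalSpace A] [MeasurableSpace A] [OpensMeasurableSpace A]

theorem integral_societalSummary {I : Type*} [MeasurableSpace I] (P : Measure I)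
    [IsProbabilityMeasure P] (g : I → ProbabilityMeasure A) (hg : Measurable g) (f : A →ᵇ ℝ) :
    ∫ x, f x ∂(societalSummary P g hg : Measure A) = ∫ i, ∫ x, f x ∂(g i : Measure A) ∂P := by
  let κ : ProbabilityTheory.Kernel I A := ⟨fun i => g i, measurable_subtype_coe.comp hg⟩
  have h : (societalSummary P g hg : Measure A) =
      (κ.comp (ProbabilityTheory.Kernel.const Unit P)) () :=
    Measure.comp_eq_comp_const_apply (κ := κ) (μ := P)
  have hf : Integrable f (societalSummary P g hg : Measure A) := f.integrable _
  rw [h] at hf ⊢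
  exact ProbabilityTheory.Kernel.integral_comp hf

theorem abs_integral_le_norm (f : A →ᵇ ℝ) (μ : ProbabilityMeasure A) :
    |∫ x, f x ∂(μ : Measure A)| ≤ ‖f‖ :=
  f.norm_integral_le_norm _

theorem abs_integral_playerMeasure_update_sub_le {J : Type*} [Fintype J] [Nonempty J]
    [MeasurableSpace J] [DiscreteMeasurableSpace J] [DecidableEq J] (h : J → ProbabilityMeasure A)
    (i : J) (μ : ProbabilityMeasure A) (f : A →ᵇ ℝ) :
    |∫ j, ∫ x, f x ∂(Function.update h i μ j : Measure A) ∂playerMeasure J -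
      ∫ j, ∫ x, f x ∂(h j : Measure A) ∂playerMeasure J| ≤
      (Fintype.card J : ℝ)⁻¹ * (2 * ‖f‖) := by
  rw [integral_playerMeasure, integral_playerMeasure, ← mul_sub, ← Finset.sum_sub_distrib,
    abs_mul, abs_of_nonneg (by positivity : (0 : ℝ) ≤ (Fintype.card J : ℝ)⁻¹),
    Finset.sum_eq_single i (fun j _ hj => by simp [hj]) (by simp)]
  gcongr
  refine (abs_sub _ _).trans ?_
  linarith [abs_integral_le_norm f (Function.update h i μ i), abs_integral_le_norm f (h i)]

/-- If the average strategies of finite sets of players converge weakly to `τ`, then the random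
societal summaries converge to `τ` in probability, uniformly in unilateral deviations. -/
theorem eventually_measure_empirical_notMem_le {ι : Type*} {l : Filter ι} {J : ι → Type*}
    [∀ n, Fintype (J n)] [∀ n, Nonempty (J n)] [∀ n, MeasurableSpace (J n)]
    [∀ n, DiscreteMeasurableSpace (J n)] [∀ n, DecidableEq (J n)]
    (hJ : Tendsto (fun n => (Fintype.card (J n) : ℝ)) l atTop)
    {h : ∀ n, J n → ProbabilityMeasure A} {τ : ProbabilityMeasure A}
    (hτ : ∀ f : A →ᵇ ℝ, Tendsto
      (fun n => ∫ j, ∫ x, f x ∂(h n j : Measure A) ∂playerMeasure (J n)) l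
      (𝓝 (∫ x, f x ∂(τ : Measure A))))
    {N : Set (ProbabilityMeasure A)} (hN : N ∈ 𝓝 τ) {δ : ℝ≥0∞} (hδ : 0 < δ) :
    ∀ᶠ n in l, ∀ (i : J n) (μ : ProbabilityMeasure A),
      Measure.pi (fun j => (Function.update (h n) i μ j : Measure A)) {a | empirical a ∉ N} ≤ δ := by
  -- The sets that capture the empirical distribution with probability tending to one, uniformly in
  -- deviations, form a filter. Comparing it with `𝓝 τ` reduces the claim to one test function at a
  -- time.
  let F : Filter (ProbabilityMeasure A) :=
    { sets := {N | ∀ δ : ℝ≥0∞, 0 < δ → ∀ᶠ n in l, ∀ (i : J n) (μ : ProbabilityMeasure A),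
        Measure.pi (fun j => (Function.update (h n) i μ j : Measure A))
          {a | empirical a ∉ N} ≤ δ}
      univ_sets := fun δ _ => by simp
      sets_of_superset := fun {N N'} hN hNN' δ hδ => by
        filter_upwards [hN δ hδ] with n hn i μ
        have hsub : {a : J n → A | empirical a ∉ N'} ⊆ {a | empirical a ∉ N} :=
          fun a ha haN => ha (hNN' haN)
        exact (measure_mono hsub).trans (hn i μ)
      inter_sets := fun {N N'} hN hN' δ hδ => by
        filter_upwards [hN (δ / 2) (ENNReal.half_pos hδ.ne'),
          hN' (δ / 2) (ENNReal.half_pos hδ.ne')] with n hn hn' i μ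
        have hsub : {a : J n → A | empirical a ∉ N ∩ N'} ⊆
            {a | empirical a ∉ N} ∪ {a | empirical a ∉ N'} := fun a ha => by
          simp only [Set.mem_ofPred_eq, Set.mem_inter_iff, not_and_or] at ha
          exact ha
        refine (measure_mono hsub).trans ((measure_union_le _ _).trans ?_)
        exact (add_le_add (hn i μ) (hn' i μ)).trans_eq (ENNReal.add_halves δ) }
  suffices hF : F ≤ 𝓝 τ from hF hN δ hδ
  refine tendsto_id'.1 (ProbabilityMeasure.tendsto_iff_forall_integral_tendsto.2 fun f => ?_)
  refine Metric.tendsto_nhds.2 fun η hη δ hδ => ?_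
  have hinv := tendsto_inv_atTop_zero.comp hJ
  have h1 : Tendsto (fun n => (Fintype.card (J n) : ℝ)⁻¹ * (2 * ‖f‖)) l (𝓝 0) := by
    simpa using hinv.mul_const (2 * ‖f‖)
  have h2 : Tendsto (fun n => ENNReal.ofReal
      ((Fintype.card (J n) : ℝ)⁻¹ * (‖f‖ ^ 2 / (η / 3) ^ 2))) l (𝓝 0) := by
    simpa using ENNReal.tendsto_ofReal (hinv.mul_const (‖f‖ ^ 2 / (η / 3) ^ 2))
  -- One third each for the random fluctuation, the shift caused by the deviation, and the distance
  -- of the average from its limit.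
  have hη3 : 0 < η / 3 := by positivity
  filter_upwards [h1.eventually_lt_const hη3, h2.eventually_le_const hδ,
    Metric.tendsto_nhds.1 (hτ f) _ hη3] with n hn1 hn2 hn3 i μ
  refine le_trans (measure_mono fun a ha => ?_)
    ((measure_integral_empirical_deviation_le (Function.update (h n) i μ) f hη3).trans hn2)
  have hupd := abs_integral_playerMeasure_update_sub_le (h n) i μ f
  simp only [Set.mem_ofPred_eq, Real.dist_eq, not_lt, id_eq] at ha hn3 ⊢
  rw [abs_le] at hupd
  rw [abs_lt] at hn3
  by_contra hcon
  rw [not_le, abs_lt] at hcon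
  refine ha.not_gt (abs_lt.2 ⟨?_, ?_⟩) <;> linarith

end Randomized

/-! ### Payoffs against a fixed summary -/

section Payoffs

variable {A : Type*} [TopologicalSpace A] [MeasurableSpace A] [OpensMeasurableSpace A]

/-- The payoff function `u` against the fixed societal summary `τ`. -/
noncomputable def Payoff.slice (u : Payoff A) (τ : ProbabilityMeasure A) : A →ᵇ ℝ :=
  u.compContinuous ⟨fun a => (a, τ), by fun_prop⟩

theorem payoffAgainst_eq_integral_slice (u : Payoff A) (μ τ : ProbabilityMeasure A) :
    payoffAgainst u μ τ = ∫ a, u.slice τ a ∂(μ : Measure A) :=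
  rfl

theorem abs_payoffAgainst_sub_le (u v : Payoff A) (μ τ : ProbabilityMeasure A) :
    |payoffAgainst u μ τ - payoffAgainst v μ τ| ≤ dist u v := by
  simp only [payoffAgainst_eq_integral_slice]
  rw [← integral_sub ((u.slice τ).integrable _) ((v.slice τ).integrable _)]
  have := norm_integral_le_of_norm_le_const (μ := (μ : Measure A)) (C := dist u v)
    (f := fun a => u.slice τ a - v.slice τ a) (.of_forall fun a =>
      BoundedContinuousFunction.dist_coe_le_dist (f := u) (g := v) (a, τ))
  simpa using this

/-- The sup norm controls the change of `u` uniformly in the strategy, leaving weak convergence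
against the fixed `u₀`. -/
theorem tendsto_payoffAgainst {ι : Type*} {l : Filter ι} {u : ι → Payoff A} {u₀ : Payoff A}
    {μ : ι → ProbabilityMeasure A} {μ₀ : ProbabilityMeasure A} (hu : Tendsto u l (𝓝 u₀))
    (hμ : Tendsto μ l (𝓝 μ₀)) (τ : ProbabilityMeasure A) :
    Tendsto (fun x => payoffAgainst (u x) (μ x) τ) l (𝓝 (payoffAgainst u₀ μ₀ τ)) := by
  have h1 : Tendsto (fun x => payoffAgainst u₀ (μ x) τ) l (𝓝 (payoffAgainst u₀ μ₀ τ)) :=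
    ProbabilityMeasure.tendsto_iff_forall_integral_tendsto.1 hμ (u₀.slice τ)
  have h2 : Tendsto (fun x => payoffAgainst (u x) (μ x) τ - payoffAgainst u₀ (μ x) τ) l (𝓝 0) :=
    squeeze_zero_norm (fun x => abs_payoffAgainst_sub_le _ _ _ _)
      (tendsto_iff_dist_tendsto_zero.1 hu)
  simpa using h2.add h1

/-- If the random societal summary is close to `τ` with high probability, the expected payoff in
the finite game is close to the payoff against `τ`. -/
theorem abs_expectedPayoff_sub_le {A : Type*} [TopologicalSpace A] [SecondCountableTopology A]
    [MeasurableSpace A] [OpensMeasurableSpace A] {J : Type*} [Fintype J] [Nonempty J]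
    [MeasurableSpace J] [DiscreteMeasurableSpace J] (G : J → Payoff A)
    (h : J → ProbabilityMeasure A) (i : J) (τ : ProbabilityMeasure A)
    {N : Set (ProbabilityMeasure A)} (hN : IsOpen N) {ε δ : ℝ} (hε₀ : 0 ≤ ε)
    (hδ : 0 ≤ δ)
    (hε : ∀ a, ∀ ν ∈ N, |G i (a, ν) - G i (a, τ)| ≤ ε)
    (hprob : Measure.pi (fun j => (h j : Measure A)) {a | empirical a ∉ N} ≤ ENNReal.ofReal δ) :
    |expectedPayoff G h i - payoffAgainst (G i) (h i) τ| ≤ ε + 2 * ‖G i‖ * δ := by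
  set Q := Measure.pi (fun j => (h j : Measure A))
  have hmeas : MeasurableSet {a : J → A | empirical a ∉ N} :=
    (hN.isClosed_compl.preimage continuous_empirical).measurableSet
  have hint1 : Integrable (fun a : J → A => G i (a i, empirical a)) Q :=
    ((G i).compContinuous ⟨fun a => (a i, empirical a),
      (continuous_apply i).prodMk continuous_empirical⟩).integrable _
  have hint2 : Integrable (fun a : J → A => G i (a i, τ)) Q :=
    (((G i).slice τ).compContinuous ⟨_, continuous_apply i⟩).integrable _
  have heq : payoffAgainst (G i) (h i) τ = ∫ a, G i (a i, τ) ∂Q :=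
    (integral_comp_eval (μ := fun j => (h j : Measure A))
      ((G i).slice τ).continuous.measurable.aestronglyMeasurable).symm
  have hbound : ∀ a : J → A, |G i (a i, empirical a) - G i (a i, τ)| ≤
      ε + {a : J → A | empirical a ∉ N}.indicator (fun _ => 2 * ‖G i‖) a := fun a => by
    by_cases ha : empirical a ∈ N
    · simpa [ha] using hε (a i) _ ha
    · have h1 := abs_le.1 ((G i).norm_coe_le_norm (a i, empirical a))
      have h2 := abs_le.1 ((G i).norm_coe_le_norm (a i, τ))
      rw [Set.indicator_of_mem (by exact ha), abs_le]
      constructor <;> linarith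
  rw [heq, expectedPayoff, ← integral_sub hint1 hint2]
  have hind : Integrable ({a : J → A | empirical a ∉ N}.indicator fun _ => 2 * ‖G i‖) Q :=
    (integrable_const _).indicator hmeas
  refine (abs_integral_le_integral_abs.trans (integral_mono (hint1.sub hint2).abs
    ((integrable_const ε).add hind) hbound)).trans ?_
  rw [integral_add' (integrable_const ε) hind, integral_indicator_const _ hmeas]
  simp only [integral_const, probReal_univ, smul_eq_mul, one_mul]
  have hreal : Q.real {a : J → A | empirical a ∉ N} ≤ δ := ENNReal.toReal_le_of_le_ofReal hδ hprob
  rw [mul_comm (2 * ‖G i‖)]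
  gcongr

end Payoffs

end LargeGame

namespace LargeGame

/-! ### Limits of direct profiles -/

section Convergence

variable {I A ι : Type*} [MeasurableSpace I] [TopologicalSpace A] [MeasurableSpace A]
  [OpensMeasurableSpace A] {P : Measure I} [IsProbabilityMeasure P] {G : I → Payoff A}
  {hG : Measurable G} {gbar : Payoff A → ProbabilityMeasure A}

/-- The finite laws give mass one to the closed support, and the portmanteau inequality for closed
sets passes this to the limit. This avoids separability of the payoff space. -/
theorem ae_mem_support_of_tendsto {l : Filter ι} [l.NeBot] {J : ι → Type*} [∀ n, Fintype (J n)]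
    [∀ n, Nonempty (J n)] [∀ n, MeasurableSpace (J n)] [∀ n, DiscreteMeasurableSpace (J n)]
    {Gn : ∀ n, J n → Payoff A}
    (hsupp : ∀ n, Set.range (Gn n) ⊆ (charDist P G hG : Measure (Payoff A)).support)
    (hconv : Tendsto (fun n => charDist (playerMeasure (J n)) (Gn n) Measurable.of_discrete) l
      (𝓝 (charDist P G hG))) :
    ∀ᵐ u ∂(charDist P G hG : Measure (Payoff A)),
      u ∈ (charDist P G hG : Measure (Payoff A)).support := by
  have hcl := Measure.isClosed_support (μ := (charDist P G hG : Measure (Payoff A)))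
  have h := ProbabilityMeasure.limsup_measure_closed_le_of_tendsto hconv hcl
  have h1 : ∀ n, (charDist (playerMeasure (J n)) (Gn n) Measurable.of_discrete :
      Measure (Payoff A)) (charDist P G hG : Measure (Payoff A)).support = 1 := fun n => by
    change (playerMeasure (J n)).map (Gn n) _ = 1
    rw [Measure.map_apply Measurable.of_discrete hcl.measurableSet,
      Set.preimage_eq_univ_iff.2 (hsupp n), measure_univ]
  simp only [h1, limsup_const] at h
  exact (prob_compl_eq_zero_iff hcl.measurableSet).2 (le_antisymm prob_le_one h)

/-- At a point of continuity, the auxiliary mapping gives a best response to `τ`, since it does so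
on a set that is dense in the support. -/
theorem payoffAgainst_le_of_continuousWithinAt {τ : ProbabilityMeasure A}
    (hbest : ∀ᵐ i ∂P, ∀ μ, payoffAgainst (G i) μ τ ≤ payoffAgainst (G i) (gbar (G i)) τ)
    (hS : ∀ᵐ u ∂(charDist P G hG : Measure (Payoff A)),
      u ∈ (charDist P G hG : Measure (Payoff A)).support)
    {u : Payoff A} (hu : u ∈ (charDist P G hG : Measure (Payoff A)).support)
    (hcont : ContinuousWithinAt gbar (charDist P G hG : Measure (Payoff A)).support u)
    (μ : ProbabilityMeasure A) :
    payoffAgainst u μ τ ≤ payoffAgainst u (gbar u) τ := by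
  have hid := tendsto_id.mono_left
    (nhdsWithin_le_nhds (a := u) (s := (charDist P G hG : Measure (Payoff A)).support))
  refine le_of_tendsto_of_tendsto_of_frequently
    (tendsto_payoffAgainst hid tendsto_const_nhds τ) (tendsto_payoffAgainst hid hcont τ) ?_
  -- Otherwise every point of the support in some neighbourhood of `u` fails the inequality; that
  -- neighbourhood has positive measure, against `hbest`.
  intro hnot
  obtain ⟨U, hU, huU, hUS⟩ := mem_nhdsWithin.1 hnot
  have hpos := (Measure.mem_support_iff_forall u).1 hu U (hU.mem_nhds huU)
  refine hpos.ne' ?_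
  change P.map G U = 0
  rw [Measure.map_apply hG hU.measurableSet]
  have : ∀ᵐ i ∂P, G i ∉ U := by
    filter_upwards [hbest, ae_of_ae_map hG.aemeasurable hS] with i hi hiS hiU
    exact hUS ⟨hiU, hiS⟩ (hi μ)
  exact measure_eq_zero_iff_ae_notMem.2 this

/-- The societal summaries of the direct profiles, averaged over players, converge. -/
theorem tendsto_integral_directProfile {τ : ProbabilityMeasure A} {l : Filter ι} {J : ι → Type*}
    [∀ n, Fintype (J n)] [∀ n, Nonempty (J n)] [∀ n, MeasurableSpace (J n)]
    [∀ n, DiscreteMeasurableSpace (J n)] {Gn : ∀ n, J n → Payoff A}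
    (hsupp : ∀ n, Set.range (Gn n) ⊆ (charDist P G hG : Measure (Payoff A)).support)
    (hconv : Tendsto (fun n => charDist (playerMeasure (J n)) (Gn n) Measurable.of_discrete) l
      (𝓝 (charDist P G hG)))
    (hS : ∀ᵐ u ∂(charDist P G hG : Measure (Payoff A)),
      u ∈ (charDist P G hG : Measure (Payoff A)).support)
    (hcont : AEContinuousOnSupport (charDist P G hG) gbar) (hg : Measurable (gbar ∘ G))
    (hτ : societalSummary P (gbar ∘ G) hg = τ) (f : A →ᵇ ℝ) :
    Tendsto (fun n => ∫ j, ∫ x, f x ∂(directProfile gbar (Gn n) j : Measure A)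
      ∂playerMeasure (J n)) l (𝓝 (∫ x, f x ∂(τ : Measure A))) := by
  classical
  have hupper : ∀ f : A →ᵇ ℝ, ∀ c, ∫ x, f x ∂(τ : Measure A) < c → ∀ᶠ n in l,
      ∫ j, ∫ x, f x ∂(directProfile gbar (Gn n) j : Measure A) ∂playerMeasure (J n) < c := by
    intro f c hc
    set S := (charDist P G hG : Measure (Payoff A)).support
    -- Off the support, `-‖f‖` is a lower bound for all the integrals, so continuity relative to the
    -- support becomes upper semicontinuity in the whole space. The finite games never see these
    -- values.
    let φ : Payoff A → ℝ := fun u => if u ∈ S then ∫ x, f x ∂(gbar u : Measure A) else -‖f‖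
    have hφS : ∀ u ∈ S, φ u = ∫ x, f x ∂(gbar u : Measure A) := fun u hu => if_pos hu
    have hφ : ∀ u, |φ u| ≤ ‖f‖ := fun u => by
      by_cases hu : u ∈ S
      · rw [hφS u hu]
        exact abs_integral_le_norm f _
      · simp [φ, hu]
    have husc : ∀ᵐ u ∂(charDist P G hG : Measure (Payoff A)), UpperSemicontinuousAt φ u := by
      filter_upwards [hS, hcont] with u huS hu y hy
      have ht := ProbabilityMeasure.tendsto_iff_forall_integral_tendsto.1 (hu huS) f
      rw [hφS u huS] at hy
      filter_upwards [eventually_nhdsWithin_iff.1 (ht.eventually_lt_const hy)] with v hv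
      by_cases hvS : v ∈ S
      · rw [hφS v hvS]
        exact hv hvS
      · simp only [φ, if_neg hvS]
        exact (abs_le.1 (abs_integral_le_norm f (gbar u))).1.trans_lt hy
    have hint : ∫ i, φ (G i) ∂P = ∫ x, f x ∂(τ : Measure A) := by
      rw [← hτ, integral_societalSummary]
      refine integral_congr_ae ?_
      filter_upwards [ae_of_ae_map hG.aemeasurable hS] with i hi using hφS _ hi
    have := eventually_integral_comp_lt hG (l := l) (Q := fun n => playerMeasure (J n))
      (Gn := Gn) (fun ψ => ?_) hφ (ae_of_ae_map hG.aemeasurable husc) (hint.trans_lt hc)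
    · filter_upwards [this] with n hn
      simpa only [hφS _ (hsupp n (Set.mem_range_self _)), directProfile,
        Function.comp_apply] using hn
    · have h := ProbabilityMeasure.tendsto_iff_forall_integral_tendsto.1 hconv ψ
      have hmap : ∫ u, ψ u ∂(P.map G) = ∫ i, ψ (G i) ∂P :=
        integral_map hG.aemeasurable ψ.continuous.measurable.aestronglyMeasurable
      have hmapn : ∀ n, ∫ u, ψ u ∂((playerMeasure (J n)).map (Gn n)) =
          ∫ j, ψ (Gn n j) ∂playerMeasure (J n) := fun n =>
        integral_map Measurable.of_discrete.aemeasurable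
          ψ.continuous.measurable.aestronglyMeasurable
      simpa only [charDist, ProbabilityMeasure.coe_mk, hmap, hmapn] using h
  refine tendsto_order.2 ⟨fun c hc => ?_, hupper f⟩
  -- The lower bound is the upper bound for `-f`.
  have := hupper (-f) (-c) (by simpa [integral_neg] using hc)
  simpa [integral_neg] using this

end Convergence

/-! ### Approximate equilibria of the finite games -/

section EpsNash

variable {I A ι : Type*} [MeasurableSpace I] [MetricSpace A] [CompactSpace A] [MeasurableSpace A]
  [BorelSpace A] {P : Measure I} [IsProbabilityMeasure P] {G : I → Payoff A}
  {hG : Measurable G} {gbar : Payoff A → ProbabilityMeasure A} {τ : ProbabilityMeasure A}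

/-- Compactness of `A` makes continuity at `τ` uniform in the action. -/
theorem eventually_forall_abs_payoff_sub_lt (u : Payoff A) {ε : ℝ} (hε : 0 < ε) :
    ∀ᶠ ν in 𝓝 τ, ∀ a, |u (a, ν) - u (a, τ)| < ε := by
  have := isCompact_univ.eventually_forall_of_forall_eventually (x₀ := τ) (K := (Set.univ : Set A))
    (P := fun ν a => |u (a, ν) - u (a, τ)| < ε) fun a _ => by
      have hc : Continuous fun z : ProbabilityMeasure A × A => |u (z.2, z.1) - u (z.2, τ)| := by
        fun_prop
      exact hc.tendsto (τ, a) |>.eventually_lt_const (by simpa using hε)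
  simpa using this

/-- There is an open set of characteristics of measure close to one on which the payoffs are
bounded and equicontinuous at `τ`, and on which the auxiliary mapping almost best-responds to
`τ`. -/
theorem exists_isOpen_good_characteristics
    (hbest : ∀ᵐ u ∂(charDist P G hG : Measure (Payoff A)),
      ∀ μ, payoffAgainst u μ τ ≤ payoffAgainst u (gbar u) τ)
    (hcont : AEContinuousOnSupport (charDist P G hG) gbar) {ε : ℝ} (hε : 0 < ε) :
    ∃ (O : Set (Payoff A)) (N : Set (ProbabilityMeasure A)) (M : ℕ), IsOpen O ∧
      ENNReal.ofReal (1 - ε) < (charDist P G hG : Measure (Payoff A)) O ∧ IsOpen N ∧ τ ∈ N ∧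
      ∀ u ∈ O, ‖u‖ ≤ M ∧ (∀ a, ∀ ν ∈ N, |u (a, ν) - u (a, τ)| ≤ ε) ∧
        (u ∈ (charDist P G hG : Measure (Payoff A)).support →
          ∀ μ, payoffAgainst u μ τ ≤ payoffAgainst u (gbar u) τ + ε) := by
  set W := (charDist P G hG : Measure (Payoff A))
  obtain ⟨N, hNopen, hN⟩ := (nhds_basis_opens τ).exists_antitone_subbasis
  -- These sets increase with `k`, and almost every `u` is interior to one of them, so their
  -- interiors have measure tending to one.
  let D : ℕ → Set (Payoff A) := fun k => {u | ‖u‖ ≤ k ∧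
    (∀ a, ∀ ν ∈ N k, |u (a, ν) - u (a, τ)| ≤ ε) ∧
    (u ∈ W.support → ∀ μ, payoffAgainst u μ τ ≤ payoffAgainst u (gbar u) τ + ε)}
  have hD : Monotone D := fun k m hkm u hu =>
    ⟨hu.1.trans (by exact_mod_cast hkm), fun a ν hν => hu.2.1 a ν (hN.antitone hkm hν), hu.2.2⟩
  have hε3 : 0 < ε / 3 := by positivity
  have hmem : ∀ᵐ u ∂W, u ∈ ⋃ k, interior (D k) := by
    filter_upwards [hbest, hcont] with u hu hcu
    obtain ⟨k₁, hk₁⟩ := exists_nat_ge (‖u‖ + ε / 3)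
    obtain ⟨k₂, hk₂⟩ := hN.mem_iff.1 (eventually_forall_abs_payoff_sub_lt (τ := τ) u hε3)
    refine Set.mem_iUnion.2 ⟨max k₁ k₂, mem_interior_iff_mem_nhds.2 ?_⟩
    have hresp : ∀ᶠ v in 𝓝 u, v ∈ W.support →
        payoffAgainst u (gbar u) τ - ε / 3 < payoffAgainst v (gbar v) τ := by
      by_cases huS : u ∈ W.support
      · refine eventually_nhdsWithin_iff.1 (Tendsto.eventually_const_lt (sub_lt_self _ hε3)
          (tendsto_payoffAgainst ?_ (hcu huS) τ))
        exact tendsto_id.mono_left nhdsWithin_le_nhds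
      · filter_upwards [Measure.isOpen_compl_support.mem_nhds huS] with v hv hvS
        exact absurd hvS hv
    filter_upwards [hresp, Metric.ball_mem_nhds u hε3] with v hv hvu
    rw [Metric.mem_ball] at hvu
    refine ⟨?_, fun a ν hν => ?_, fun hvS μ => ?_⟩
    · have h1 : ‖v‖ ≤ ‖u‖ + dist v u := by
        rw [dist_eq_norm]
        exact norm_le_norm_add_norm_sub' v u
      have h2 : (k₁ : ℝ) ≤ (max k₁ k₂ : ℕ) := by exact_mod_cast le_max_left _ _
      linarith
    · have h1 := abs_le.1 (BoundedContinuousFunction.dist_coe_le_dist (f := v) (g := u) (a, ν))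
      have h2 := abs_le.1 (BoundedContinuousFunction.dist_coe_le_dist (f := v) (g := u) (a, τ))
      have h3 := abs_lt.1 (hk₂ (hN.antitone (le_max_right k₁ k₂) hν) a)
      rw [abs_le]
      constructor <;> linarith
    · have h1 := abs_le.1 (abs_payoffAgainst_sub_le v u μ τ)
      linarith [hv hvS, hu μ]
  have hlim := tendsto_measure_iUnion_atTop (μ := W) (s := fun k => interior (D k))
    fun k m hkm => interior_mono (hD hkm)
  rw [(prob_compl_eq_zero_iff (MeasurableSet.iUnion fun k => isOpen_interior.measurableSet)).1
    hmem] at hlim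
  have hlt : ENNReal.ofReal (1 - ε) < 1 := by
    rw [ENNReal.ofReal_lt_one]
    linarith
  obtain ⟨k, hk⟩ := (hlim.eventually_const_lt hlt).exists
  exact ⟨interior (D k), N k, k, isOpen_interior, hk, (hNopen k).2, (hNopen k).1,
    fun u hu => (interior_subset hu : u ∈ D k)⟩

theorem eventually_isEpsNash_directProfile {l : Filter ι} [l.NeBot] {J : ι → Type*}
    [∀ n, Fintype (J n)] [∀ n, Nonempty (J n)] [∀ n, MeasurableSpace (J n)]
    [∀ n, DiscreteMeasurableSpace (J n)]
    (hJ : Tendsto (fun n => (Fintype.card (J n) : ℝ)) l atTop) {Gn : ∀ n, J n → Payoff A}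
    (hsupp : ∀ n, Set.range (Gn n) ⊆ (charDist P G hG : Measure (Payoff A)).support)
    (hconv : Tendsto (fun n => charDist (playerMeasure (J n)) (Gn n) Measurable.of_discrete) l
      (𝓝 (charDist P G hG)))
    (hgbar : IsAuxiliaryMapping P G τ gbar)
    (hcont : AEContinuousOnSupport (charDist P G hG) gbar) {ε : ℝ} (hε : 0 < ε) :
    ∀ᶠ n in l, IsEpsNash (Gn n) ε (directProfile gbar (Gn n)) := by
  classical
  obtain ⟨hg, hnash, hτ⟩ := hgbar
  rw [IsNash, hτ] at hnash
  have hS := ae_mem_support_of_tendsto hsupp hconv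
  -- The best-response set in `u` is not known to be measurable, so it is reached through continuity
  -- points rather than by pushing forward `hnash`.
  have hbest : ∀ᵐ u ∂(charDist P G hG : Measure (Payoff A)),
      ∀ μ, payoffAgainst u μ τ ≤ payoffAgainst u (gbar u) τ := by
    filter_upwards [hS, hcont] with u huS hu μ
    exact payoffAgainst_le_of_continuousWithinAt hnash hS huS (hu huS) μ
  -- Two fifths for each of the two payoff comparisons with `τ`, one fifth for the best-response
  -- slack.
  have hε5 : 0 < ε / 5 := by positivity
  obtain ⟨O, N, M, hO, hWO, hN, hτN, hgood⟩ :=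
    exists_isOpen_good_characteristics hbest hcont hε5
  -- Chosen so that `2 * ‖u‖ * δ ≤ ε / 5` whenever `‖u‖ ≤ M`; the `+ 1` covers `M = 0`.
  have hδ : 0 < ε / 5 / (2 * (M + 1)) := by positivity
  have hOn := eventually_lt_of_lt_liminf (hWO.trans_le
    (ProbabilityMeasure.le_liminf_measure_open_of_tendsto hconv hO))
  filter_upwards [hOn, eventually_measure_empirical_notMem_le hJ
    (tendsto_integral_directProfile hsupp hconv hS hcont hg hτ) (hN.mem_nhds hτN)
    (ENNReal.ofReal_pos.2 hδ)] with n hn hprob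
  refine ⟨Gn n ⁻¹' O, ?_, fun i hi μ => ?_⟩
  · change _ < (playerMeasure (J n)).map (Gn n) O at hn
    rw [Measure.map_apply Measurable.of_discrete hO.measurableSet] at hn
    have := (ENNReal.ofReal_le_iff_le_toReal (measure_ne_top _ _)).1 hn.le
    change _ ≤ (playerMeasure (J n)).real _ at this
    linarith
  · obtain ⟨hM, heq, hresp⟩ := hgood _ hi
    have hdev : ∀ μ, |expectedPayoff (Gn n) (Function.update (directProfile gbar (Gn n)) i μ) i -
        payoffAgainst (Gn n i) μ τ| ≤ 2 * (ε / 5) := fun μ => by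
      have h := abs_expectedPayoff_sub_le (Gn n)
        (Function.update (directProfile gbar (Gn n)) i μ) i τ hN hε5.le hδ.le heq (hprob i μ)
      rw [Function.update_self] at h
      have h2 : 2 * ‖Gn n i‖ * (ε / 5 / (2 * (M + 1))) ≤ ε / 5 := by
        rw [← mul_div_assoc, div_le_iff₀ (by positivity)]
        nlinarith
      linarith
    have h1 := abs_le.1 (hdev μ)
    -- The undeviated profile is the deviation to the player's own strategy.
    have h2 := abs_le.1 (hdev (directProfile gbar (Gn n) i))
    rw [Function.update_eq_self] at h2
    have h3 := hresp (hsupp n (Set.mem_range_self i)) μ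
    change _ ≤ payoffAgainst (Gn n i) (directProfile gbar (Gn n) i) τ + _ at h3
    linarith

theorem IsEpsNash.mono {J A : Type*} [Fintype J] [Nonempty J] [MeasurableSpace J]
    [DiscreteMeasurableSpace J] [TopologicalSpace A] [MeasurableSpace A] [OpensMeasurableSpace A]
    {G : J → Payoff A} {g : J → ProbabilityMeasure A} {ε ε' : ℝ} (h : IsEpsNash G ε g)
    (hε : ε ≤ ε') : IsEpsNash G ε' g := by
  obtain ⟨S, hS, hdev⟩ := h
  exact ⟨S, by linarith, fun i hi μ => by linarith [hdev i hi μ]⟩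

/-- The empty set of players suffices; this keeps the sets of admissible tolerances nonempty for
every `n`. -/
theorem isEpsNash_one {J A : Type*} [Fintype J] [Nonempty J] [MeasurableSpace J]
    [DiscreteMeasurableSpace J] [TopologicalSpace A] [MeasurableSpace A] [OpensMeasurableSpace A]
    (G : J → Payoff A) (g : J → ProbabilityMeasure A) : IsEpsNash G 1 g :=
  ⟨∅, by simp, by simp⟩

end EpsNash

/-- A monotone property of real tolerances that holds eventually for every positive tolerance
holds along a sequence of tolerances tending to zero. -/
theorem exists_tendsto_zero_of_forall_eventually {p : ℕ+ → ℝ → Prop}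
    (hmono : ∀ n a b, a ≤ b → p n a → p n b) (hone : ∀ n, p n 1)
    (hp : ∀ ε > 0, ∀ᶠ n in atTop, p n ε) :
    ∃ ε : ℕ+ → ℝ, (∀ n, 0 ≤ ε n) ∧ Tendsto ε atTop (𝓝 0) ∧ ∀ n, p n (ε n) := by
  let T : ℕ+ → Set ℝ := fun n => {e | 0 ≤ e ∧ p n e}
  have hT : ∀ n, (T n).Nonempty := fun n => ⟨1, zero_le_one, hone n⟩
  have hbdd : ∀ n, BddBelow (T n) := fun n => ⟨0, fun e he => he.1⟩
  have hnonneg : ∀ n, 0 ≤ sInf (T n) := fun n => le_csInf (hT n) fun e he => he.1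
  have hpos : ∀ n : ℕ+, 0 < ((n : ℕ) : ℝ)⁻¹ := fun n => by positivity
  have hinv : Tendsto (fun n : ℕ+ => ((n : ℕ) : ℝ)⁻¹) atTop (𝓝 0) :=
    tendsto_inv_atTop_zero.comp (tendsto_natCast_atTop_atTop.comp tendsto_PNat_val_atTop_atTop)
  have hinf : Tendsto (fun n => sInf (T n)) atTop (𝓝 0) := by
    refine tendsto_order.2 ⟨fun a ha => .of_forall fun n => ha.trans_le (hnonneg n), fun b hb => ?_⟩
    filter_upwards [hp (b / 2) (half_pos hb)] with n hn
    exact (csInf_le (hbdd n) ⟨(half_pos hb).le, hn⟩).trans_lt (half_lt_self hb)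
  -- The infimum need not be attained; adding `1 / n` ensures that an admissible tolerance lies
  -- below.
  refine ⟨fun n => sInf (T n) + ((n : ℕ) : ℝ)⁻¹, fun n => add_nonneg (hnonneg n) (hpos n).le,
    by simpa using hinf.add hinv, fun n => ?_⟩
  obtain ⟨e, he, hlt⟩ := exists_lt_of_csInf_lt (hT n) (lt_add_of_pos_right _ (hpos n))
  exact hmono n _ _ hlt.le he.2

end LargeGame

theorem theorem1
    {I A : Type*} [MeasurableSpace I]
    [MetricSpace A] [CompactSpace A] [MeasurableSpace A] [BorelSpace A]
    -- the large game `G` on a complete atomless probability space of players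
    (P : Measure I) [IsProbabilityMeasure P] [P.IsComplete] (hP : LargeGame.IsAtomless P)
    (G : I → LargeGame.Payoff A) (hG : Measurable G)
    -- the finite-player games `Gn n` with `n` players, for every positive integer `n`
    (J : ℕ+ → Type*) [∀ n, Fintype (J n)] [∀ n, Nonempty (J n)]
    [∀ n, MeasurableSpace (J n)] [∀ n, DiscreteMeasurableSpace (J n)]
    (hJ : ∀ n : ℕ+, Fintype.card (J n) = (n : ℕ))
    (Gn : ∀ n, J n → LargeGame.Payoff A)
    (hsupp : ∀ n, Set.range (Gn n) ⊆
      (LargeGame.charDist P G hG : Measure (LargeGame.Payoff A)).support)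
    -- convergence of the games: weak convergence of the characteristic distributions
    (hconv : Tendsto
      (fun n => LargeGame.charDist (LargeGame.playerMeasure (J n)) (Gn n) Measurable.of_discrete)
      atTop (𝓝 (LargeGame.charDist P G hG)))
    -- the auxiliary mapping, almost everywhere continuous on the support
    (τ : ProbabilityMeasure A) (hτ : LargeGame.IsEquilibriumActionDistribution P G τ)
    (gbar : LargeGame.Payoff A → ProbabilityMeasure A)
    (hgbar : LargeGame.IsAuxiliaryMapping P G τ gbar)
    (hcont : LargeGame.AEContinuousOnSupport (LargeGame.charDist P G hG) gbar) :
    ∃ ε : ℕ+ → ℝ, (∀ n, 0 ≤ ε n) ∧ Tendsto ε atTop (𝓝 0) ∧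
      ∀ n, LargeGame.IsEpsNash (Gn n) (ε n) (LargeGame.directProfile gbar (Gn n)) :=
  LargeGame.exists_tendsto_zero_of_forall_eventually
    (p := fun n ε => LargeGame.IsEpsNash (Gn n) ε (LargeGame.directProfile gbar (Gn n)))
    (fun _ _ _ hab h => h.mono hab) (fun _ => LargeGame.isEpsNash_one _ _)
    fun _ hε => LargeGame.eventually_isEpsNash_directProfile
      (by
        simp only [hJ]
        exact tendsto_natCast_atTop_atTop.comp tendsto_PNat_val_atTop_atTop)
      hsupp hconv hgbar hcont hε
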